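/- For real $r,s$ and $x,y>0$ let $I_{r,s}(x,y)$ denote the Stolarsky mean: $I_{r,s}(x,x)=x$, and for $x\ne y$ $$I_{r,s}(x,y)=\begin{cases}\left(\dfrac{r(x^s-y^s)}{s(x^r-y^r)}\right)^{1/(s-r)}, & rs(r-s)\ne 0,\\[2mm] \exp\left(-\dfrac1s+\dfrac{x^s\log x-y^s\log y}{x^s-y^s}\right), & r=s\neq 0,\\[2mm] \left(\dfrac{x^s-y^s}{s(\log x-\log y)}\right)^{1/s}, & s\ne0,\ r=0,\\[2mm] \sqrt{xy}, & r=s=0,\end{cases}$$ with $I_{r,0}=I_{0,r}$ for $r\neq 0$. Put $S(a,b)=a^{\frac a{a+b}}b^{\frac b{a+b}}$ and $S_*(a,b)=a^{\frac b{a+b}}b^{\frac a{a+b}}$ for $a,b>0$. Let $\Omega$ be the class of maps $M:(0,\infty)^2\to(0,\infty)$ with $\min(a,b)\le M(a,b)\le\max(a,b)$ that are symmetric, reflexive ($M(a,a)=a$) and homogeneous of order one, and write $M\le N$ if $M(a,b)\le N(a,b)$ for all $a,b>0$. For a class $\Delta\subset\Omega$, a mean $T\in\Omega$ is called a right cancelling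 mean for $\Delta$ if $M\le T$ for some $M\in\Delta$ but $T\le N$ for no $N\in\Delta$; it is called a left cancelling mean for $\Delta$ if $T\le M$ for some $M\in\Delta$ but $N\le T$ for no $N\in\Delta$. A class is ordered if any two of its members are comparable for $\le$. **Theorem.** 1. For $-3\le r\le s\le 3$ and all $a,b>0$, $$a^{\frac b{a+b}}b^{\frac a{a+b}}\le I_{-3,-3}(a,b)\le I_{r,s}(a,b)\le I_{3,3}(a,b)\le a^{\frac a{a+b}}b^{\frac b{a+b}}.$$ 2. The constants $\pm3$ are best possible: $3$ is the largest real $p$ such that $I_{p,p}\le S$, and $-3$ is the smallest real $p$ such that $S_*\le I_{p,p}$. 3. $S_*(a,b)=ab/S(a,b)$ for all $a,b>0$. Both the class $\{I_{r,s}: r,s\in\mathbb R\}$ and its subclass $\{I_{s,s}: s\in\mathbb R\}$ are contained in $\Omega$, the subclass is ordered, and for each of these two classes $S_*$ is a left cancelling mean and $S$ is a right cancelling mean. -/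

import Mathlib

/-! Two-variable means are represented by functions `ℝ → ℝ → ℝ`; every notion below only looks at
their values at positive arguments. -/

namespace MeanHierarchy

/-- `M ≤ N` in the partial order of means: `M(a,b) ≤ N(a,b)` for all `a, b > 0`. -/
def MeanLE (M N : ℝ → ℝ → ℝ) : Prop :=
  ∀ a b : ℝ, 0 < a → 0 < b → M a b ≤ N a b

/-- The class `Ω` of symmetric, reflexive means that are homogeneous of order one. -/
structure IsOmegaMean (M : ℝ → ℝ → ℝ) : Prop where
  min_le : ∀ a b : ℝ, 0 < a → 0 < b → min a b ≤ M a b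
  le_max : ∀ a b : ℝ, 0 < a → 0 < b → M a b ≤ max a b
  symmetric : ∀ a b : ℝ, 0 < a → 0 < b → M a b = M b a
  reflexive : ∀ a : ℝ, 0 < a → M a a = a
  homogeneous : ∀ t a b : ℝ, 0 < t → 0 < a → 0 < b → M (t * a) (t * b) = t * M a b

/-- A family of means is ordered if any two of its members are comparable. -/
def IsOrderedFamily (Δ : Set (ℝ → ℝ → ℝ)) : Prop :=
  ∀ M ∈ Δ, ∀ N ∈ Δ, MeanLE M N ∨ MeanLE N M

/-- `S` is a right cancelling mean for the class `Δ ⊆ Ω`: some member of `Δ` lies below `S`, but no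
member of `Δ` lies above `S`. That `Δ` is ordered is expressed separately by `IsOrderedFamily`. -/
structure IsRightCancelling (Δ : Set (ℝ → ℝ → ℝ)) (S : ℝ → ℝ → ℝ) : Prop where
  subset_omega : ∀ M ∈ Δ, IsOmegaMean M
  mem_omega : IsOmegaMean S
  exists_le : ∃ M ∈ Δ, MeanLE M S
  not_exists_ge : ¬ ∃ N ∈ Δ, MeanLE S N

/-- `S` is a left cancelling mean for the class `Δ ⊆ Ω`: some member of `Δ` lies above `S`, but no
member of `Δ` lies below `S`. -/
structure IsLeftCancelling (Δ : Set (ℝ → ℝ → ℝ)) (S : ℝ → ℝ → ℝ) : Prop where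
  subset_omega : ∀ M ∈ Δ, IsOmegaMean M
  mem_omega : IsOmegaMean S
  exists_ge : ∃ M ∈ Δ, MeanLE S M
  not_exists_le : ¬ ∃ N ∈ Δ, MeanLE N S

/-- The Stolarsky (extended) mean `I_{r,s}(x,y)` for `x, y > 0`. The case `s = 0 ≠ r` is given by
the symmetry `I_{r,s} = I_{s,r}`. -/
noncomputable def stolarsky (r s x y : ℝ) : ℝ :=
  if x = y then x
  else if r = s then
    if s = 0 then Real.sqrt (x * y)
    else Real.exp (-(1 / s) + (x ^ s * Real.log x - y ^ s * Real.log y) / (x ^ s - y ^ s))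
  else if r = 0 then ((x ^ s - y ^ s) / (s * (Real.log x - Real.log y))) ^ (1 / s)
  else if s = 0 then ((x ^ r - y ^ r) / (r * (Real.log x - Real.log y))) ^ (1 / r)
  else (r * (x ^ s - y ^ s) / (s * (x ^ r - y ^ r))) ^ (1 / (s - r))

/-- The class of all Stolarsky means `I_{r,s}`, `r, s ∈ ℝ`. -/
def stolarskyClass : Set (ℝ → ℝ → ℝ) :=
  {M | ∃ r s : ℝ, M = stolarsky r s}

/-- The one-parameter class of the Stolarsky means `I_{s,s}`, `s ∈ ℝ`. -/
def stolarskyDiagonal : Set (ℝ → ℝ → ℝ) :=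
  {M | ∃ s : ℝ, M = stolarsky s s}

/-- The Gini mean `S(a,b) = a^{a/(a+b)} b^{b/(a+b)}`. -/
noncomputable def gini (a b : ℝ) : ℝ :=
  a ^ (a / (a + b)) * b ^ (b / (a + b))

/-- The mean `a^{b/(a+b)} b^{a/(a+b)}`. -/
noncomputable def giniDual (a b : ℝ) : ℝ :=
  a ^ (b / (a + b)) * b ^ (a / (a + b))

end MeanHierarchy

namespace MeanHierarchy

open Real Filter Topology

/-! With `a = exp (m + t)` and `b = exp (m - t)`, each mean becomes `exp (m + f t)`: `f t = ± t *
tanh t` for `gini` and `giniDual`, and for `I_{r,s}` the slope between `r` and `s` of `y ↦ logSinhc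
(y * t)`. That function has derivative `t * langevin (y * t)`, so by the mean value theorem
`I_{r,s}` agrees at each `t` with some diagonal mean, and monotonicity of `langevin` orders
everything (`exists_logStolarsky_eq`, `stolarsky_le_self`). The bound `I_{3,3} ≤ S` is the
Cusa–Huygens inequality at `2 * t`. The constant `3` is sharp as `t → 0`, where `langevin (p * t) ~
p * t / 3` and `tanh t ~ t`. No `I_{p,p}` dominates `S`, because for large `t` the gap `1 - tanh t`
is exponentially small while `1 - langevin (p * t)` is of order `1 / t`. Negating the parameters
negates `f`, which transfers all of this to `S_*`. -/

/-- The logarithm of the hyperbolic cardinal sine; its value at `0` is `0`. -/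
noncomputable def logSinhc (z : ℝ) : ℝ := log (sinh z / z)

/-- The Langevin function `coth z - 1/z`; its value at `0` is `0`. -/
noncomputable def langevin (z : ℝ) : ℝ := cosh z / sinh z - 1 / z

/-- The logarithm of `I_{r,s}(e^t, e^{-t})`. -/
noncomputable def logStolarsky (r s t : ℝ) : ℝ :=
  if r = s then t * langevin (s * t) else (logSinhc (s * t) - logSinhc (r * t)) / (s - r)

@[simp] lemma logSinhc_zero : logSinhc 0 = 0 := by simp [logSinhc]

@[simp] lemma langevin_zero : langevin 0 = 0 := by simp [langevin]

lemma langevin_neg (z : ℝ) : langevin (-z) = -langevin z := by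
  simp only [langevin, cosh_neg, sinh_neg, div_neg]; ring

lemma logSinhc_neg (z : ℝ) : logSinhc (-z) = logSinhc z := by
  simp only [logSinhc, sinh_neg, neg_div_neg_eq]

lemma sinh_ne_zero_of_ne_zero {z : ℝ} (hz : z ≠ 0) : sinh z ≠ 0 := by
  simpa using hz

lemma sinh_div_self_pos {z : ℝ} (hz : z ≠ 0) : 0 < sinh z / z := by
  rcases lt_or_gt_of_ne hz with h | h
  · exact div_pos_of_neg_of_neg (sinh_neg_iff.2 h) h
  · exact div_pos (sinh_pos_iff.2 h) h

/-! ### Elementary hyperbolic inequalities -/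

lemma nonneg_of_hasDerivAt_nonneg {f f' : ℝ → ℝ} (hf : ∀ x, HasDerivAt f (f' x) x)
    (h0 : f 0 = 0) (hf' : ∀ x, 0 ≤ x → 0 ≤ f' x) {x : ℝ} (hx : 0 ≤ x) : 0 ≤ f x := by
  have hm : MonotoneOn f (Set.Ici 0) := by
    apply monotoneOn_of_deriv_nonneg (convex_Ici 0)
    · exact fun y _ => (hf y).continuousAt.continuousWithinAt
    · exact fun y _ => (hf y).differentiableAt.differentiableWithinAt
    · intro y hy
      rw [interior_Ici] at hy
      rw [(hf y).deriv]
      exact hf' y (le_of_lt hy)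
  simpa [h0] using hm Set.self_mem_Ici hx hx

lemma cube_div_three_le_mul_cosh_sub_sinh {x : ℝ} (hx : 0 ≤ x) :
    x ^ 3 / 3 ≤ x * cosh x - sinh x := by
  have h := nonneg_of_hasDerivAt_nonneg (f := fun y => y * cosh y - sinh y - y ^ 3 / 3)
    (f' := fun y => y * sinh y - y ^ 2) (fun y => by
      refine ((((hasDerivAt_id y).mul (hasDerivAt_cosh y)).sub (hasDerivAt_sinh y)).sub
        (((hasDerivAt_id y).pow 3).div_const 3)).congr_deriv ?_
      simp) (by simp)
    (fun y hy => by nlinarith [self_le_sinh_iff.2 hy]) hx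
  simpa using h

lemma sinh_le_mul_cosh {x : ℝ} (hx : 0 ≤ x) : sinh x ≤ x * cosh x := by
  have := cube_div_three_le_mul_cosh_sub_sinh hx
  have : 0 ≤ x ^ 3 := by positivity
  linarith

lemma self_add_cube_div_six_le_sinh {x : ℝ} (hx : 0 ≤ x) : x + x ^ 3 / 6 ≤ sinh x := by
  have h := nonneg_of_hasDerivAt_nonneg (f := fun y => sinh y - (y + y ^ 3 / 6))
    (f' := fun y => cosh y - (1 + y ^ 2 / 2)) (fun y => by
      refine ((hasDerivAt_sinh y).sub
        ((hasDerivAt_id y).add (((hasDerivAt_id y).pow 3).div_const 6))).congr_deriv ?_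
      simp; ring) (by simp)
    (fun y hy => by
      have h1 : cosh y = 1 + 2 * sinh (y / 2) ^ 2 := by
        have := cosh_two_mul (y / 2)
        rw [cosh_sq, mul_div_cancel₀ y two_ne_zero] at this
        linarith
      have h2 : y / 2 ≤ sinh (y / 2) := self_le_sinh_iff.2 (by positivity)
      nlinarith) hx
  simpa using h

/-- The hyperbolic Cusa–Huygens inequality in product form. -/
lemma three_mul_mul_cosh_le {u : ℝ} (hu : 0 ≤ u) :
    3 * u * cosh u ≤ sinh u * (2 * cosh u + 1) := by
  -- Dividing by `cosh` makes the derivative a rational function of `cosh y` alone, with a double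
  -- zero at `cosh y = 1`.
  have h := nonneg_of_hasDerivAt_nonneg (f := fun y => 2 * sinh y + sinh y / cosh y - 3 * y)
    (f' := fun y => 2 * cosh y + (cosh y * cosh y - sinh y * sinh y) / cosh y ^ 2 - 3) (fun y => by
      refine ((((hasDerivAt_sinh y).const_mul 2).add
        ((hasDerivAt_sinh y).div (hasDerivAt_cosh y) (cosh_pos y).ne')).sub
        ((hasDerivAt_id y).const_mul 3)).congr_deriv ?_
      simp) (by simp)
    (fun y hy => by
      have hc := one_le_cosh y
      have h1 : cosh y * cosh y - sinh y * sinh y = 1 := by nlinarith [cosh_sq y]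
      have h2 : 0 < cosh y := cosh_pos y
      have h3 : 2 * cosh y + 1 / cosh y ^ 2 - 3 =
          (cosh y - 1) ^ 2 * (2 * cosh y + 1) / cosh y ^ 2 := by
        field_simp; ring
      simp only [h1, h3]
      positivity) hu
  have hc := cosh_pos u
  have : sinh u * (2 * cosh u + 1) - 3 * u * cosh u =
      (2 * sinh u + sinh u / cosh u - 3 * u) * cosh u := by field_simp
  nlinarith [mul_nonneg h hc.le]

/-! ### Calculus of `logSinhc` and `langevin` -/

lemma logSinhc_bounds (z : ℝ) : 0 ≤ logSinhc z ∧ logSinhc z ≤ z ^ 2 / 2 := by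
  wlog hz : 0 ≤ z generalizing z
  · have := this (-z) (by linarith)
    rwa [logSinhc_neg, neg_sq] at this
  rcases hz.eq_or_lt with rfl | hz
  · simp
  have h1 : 1 ≤ sinh z / z := (one_le_div hz).2 (self_le_sinh_iff.2 hz.le)
  refine ⟨log_nonneg h1, ?_⟩
  rw [logSinhc, log_le_iff_le_exp (by linarith)]
  refine le_trans ?_ (cosh_le_exp_half_sq z)
  rw [div_le_iff₀ hz, mul_comm]
  exact sinh_le_mul_cosh hz.le

lemma hasDerivAt_logSinhc (z : ℝ) : HasDerivAt logSinhc (langevin z) z := by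
  rcases eq_or_ne z 0 with rfl | hz
  -- The default value `log (0 / 0) = 0` is the true limit at `0`, and the quadratic bound gives
  -- derivative `0` there.
  · rw [langevin_zero, hasDerivAt_iff_isLittleO]
    simp only [logSinhc_zero, sub_zero, smul_zero]
    have h1 : logSinhc =O[𝓝 0] fun z : ℝ => z ^ 2 := by
      refine Asymptotics.IsBigO.of_bound 1 (Eventually.of_forall fun z => ?_)
      have := logSinhc_bounds z
      rw [norm_of_nonneg this.1, norm_of_nonneg (sq_nonneg z)]
      nlinarith [sq_nonneg z]
    exact h1.trans_isLittleO (Asymptotics.isLittleO_pow_id one_lt_two)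
  · have hs := sinh_ne_zero_of_ne_zero hz
    refine (((hasDerivAt_sinh z).div (hasDerivAt_id z) hz).log
      (sinh_div_self_pos hz).ne').congr_deriv ?_
    simp only [langevin, id, Pi.div_apply]
    field_simp

lemma langevin_nonneg {z : ℝ} (hz : 0 ≤ z) : 0 ≤ langevin z := by
  rcases hz.eq_or_lt with rfl | hz
  · simp
  rw [langevin, sub_nonneg, div_le_div_iff₀ hz (sinh_pos_iff.2 hz)]
  linarith [sinh_le_mul_cosh hz.le]

lemma langevin_le_one {z : ℝ} (hz : 0 ≤ z) : langevin z ≤ 1 := by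
  rcases hz.eq_or_lt with rfl | hz
  · simp
  have hs := sinh_pos_iff.2 hz
  have h : langevin z = (z * cosh z - sinh z) / (z * sinh z) := by
    rw [langevin]; field_simp
  rw [h, div_le_one (by positivity)]
  have h1 : cosh z - sinh z = exp (-z) := cosh_sub_sinh z
  have h2 : exp (-z) ≤ 1 := exp_le_one_iff.2 (by linarith)
  have h3 : z ≤ sinh z := self_le_sinh_iff.2 hz.le
  nlinarith

lemma hasDerivAt_langevin {z : ℝ} (hz : z ≠ 0) :
    HasDerivAt langevin (1 / z ^ 2 - 1 / sinh z ^ 2) z := by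
  have hs := sinh_ne_zero_of_ne_zero hz
  refine (((hasDerivAt_cosh z).div (hasDerivAt_sinh z) hs).sub
    ((hasDerivAt_const z (1 : ℝ)).div (hasDerivAt_id z) hz)).congr_deriv ?_
  simp only [id]
  have := cosh_sq z
  field_simp
  rw [this]; ring

lemma monotone_langevin : Monotone langevin := by
  have hpos : MonotoneOn langevin (Set.Ioi 0) := by
    apply monotoneOn_of_deriv_nonneg (convex_Ioi 0)
    · exact fun y hy => (hasDerivAt_langevin (ne_of_gt hy)).continuousAt.continuousWithinAt
    · rw [interior_Ioi]
      exact fun y hy =>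
        (hasDerivAt_langevin (ne_of_gt hy)).differentiableAt.differentiableWithinAt
    · rw [interior_Ioi]
      intro y (hy : 0 < y)
      rw [(hasDerivAt_langevin hy.ne').deriv, sub_nonneg]
      exact one_div_le_one_div_of_le (by positivity)
        (pow_le_pow_left₀ hy.le (self_le_sinh_iff.2 hy.le) 2)
  refine monotone_of_odd_of_monotoneOn_nonneg langevin_neg ?_
  intro x (hx : 0 ≤ x) y _ hxy
  rcases hx.eq_or_lt with rfl | hx
  · simpa using langevin_nonneg hxy
  · exact hpos hx (hx.trans_le hxy) hxy

lemma mul_langevin_mono (t : ℝ) : Monotone fun s => t * langevin (s * t) := by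
  intro r s h
  rcases le_total 0 t with ht | ht
  · exact mul_le_mul_of_nonneg_left (monotone_langevin (by gcongr)) ht
  · exact mul_le_mul_of_nonpos_left
      (monotone_langevin (mul_le_mul_of_nonpos_right h ht)) ht

lemma abs_mul_langevin_le (t z : ℝ) : |t * langevin z| ≤ |t| := by
  rw [abs_mul]
  refine mul_le_of_le_one_right (abs_nonneg t) ?_
  wlog hz : 0 ≤ z generalizing z
  · simpa [langevin_neg] using this (-z) (by linarith)
  rw [abs_of_nonneg (langevin_nonneg hz)]
  exact langevin_le_one hz

lemma logStolarsky_self (s t : ℝ) : logStolarsky s s t = t * langevin (s * t) := if_pos rfl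

lemma logStolarsky_symm (r s t : ℝ) : logStolarsky r s t = logStolarsky s r t := by
  unfold logStolarsky
  split_ifs with h1 h2 h2
  · rw [h1]
  · exact absurd h1.symm h2
  · exact absurd h2.symm h1
  · rw [← neg_sub, ← neg_sub r s, neg_div_neg_eq]

lemma logStolarsky_neg (r s t : ℝ) : logStolarsky r s (-t) = logStolarsky r s t := by
  simp only [logStolarsky, mul_neg, logSinhc_neg, langevin_neg, neg_mul, neg_neg]

/-- Mean value theorem in the parameter with `t` fixed; `ξ` may depend on `t`. This reduces bounds
on all `I_{r,s}` to the diagonal. -/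
lemma exists_logStolarsky_eq (t : ℝ) {r s : ℝ} (h : r ≤ s) :
    ∃ ξ ∈ Set.Icc r s, logStolarsky r s t = t * langevin (ξ * t) := by
  rcases h.eq_or_lt with rfl | h
  · exact ⟨r, ⟨le_rfl, le_rfl⟩, logStolarsky_self r t⟩
  have hd (x : ℝ) : HasDerivAt (fun y => logSinhc (y * t)) (t * langevin (x * t)) x := by
    refine ((hasDerivAt_logSinhc (x * t)).comp x ((hasDerivAt_id x).mul_const t)).congr_deriv ?_
    ring
  obtain ⟨ξ, hξ, he⟩ := exists_hasDerivAt_eq_slope _ _ h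
    (fun x _ => (hd x).continuousAt.continuousWithinAt) (fun x _ => hd x)
  exact ⟨ξ, Set.Ioo_subset_Icc_self hξ, by rw [he, logStolarsky, if_neg h.ne]⟩

lemma abs_logStolarsky_le (r s t : ℝ) : |logStolarsky r s t| ≤ |t| := by
  wlog h : r ≤ s generalizing r s
  · rw [logStolarsky_symm]; exact this s r (le_of_not_ge h)
  obtain ⟨ξ, -, he⟩ := exists_logStolarsky_eq t h
  rw [he]
  exact abs_mul_langevin_le _ _

/-! ### The means in exponential coordinates -/

lemma exists_exp_add_exp_sub {a b : ℝ} (ha : 0 < a) (hb : 0 < b) :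
    ∃ m t : ℝ, a = exp (m + t) ∧ b = exp (m - t) := by
  refine ⟨(log a + log b) / 2, (log a - log b) / 2, ?_, ?_⟩
  · rw [← add_div, show (log a + log b + (log a - log b)) / 2 = log a by ring, exp_log ha]
  · rw [← sub_div, show (log a + log b - (log a - log b)) / 2 = log b by ring, exp_log hb]

lemma exp_add_rpow_sub_exp_sub_rpow (m t s : ℝ) :
    exp (m + t) ^ s - exp (m - t) ^ s = 2 * exp (m * s) * sinh (s * t) := by
  rw [← exp_mul, ← exp_mul, add_mul, sub_mul, sub_eq_add_neg (m * s), exp_add, exp_add, sinh_eq,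
    mul_comm t s]
  ring

lemma exp_add_rpow_add_exp_sub_rpow (m t s : ℝ) :
    exp (m + t) ^ s + exp (m - t) ^ s = 2 * exp (m * s) * cosh (s * t) := by
  rw [← exp_mul, ← exp_mul, add_mul, sub_mul, sub_eq_add_neg (m * s), exp_add, exp_add, cosh_eq,
    mul_comm t s]
  ring

lemma rpow_sub_div_log_sub_rpow {m t s : ℝ} (ht : t ≠ 0) (hs : s ≠ 0) :
    ((exp (m + t) ^ s - exp (m - t) ^ s) / (s * (log (exp (m + t)) - log (exp (m - t))))) ^ (1 / s)
      = exp (m + logSinhc (s * t) / s) := by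
  have hst : s * t ≠ 0 := mul_ne_zero hs ht
  have h : (exp (m + t) ^ s - exp (m - t) ^ s) / (s * (log (exp (m + t)) - log (exp (m - t))))
      = exp (m * s + logSinhc (s * t)) := by
    rw [exp_add_rpow_sub_exp_sub_rpow, log_exp, log_exp, exp_add, logSinhc,
      exp_log (sinh_div_self_pos hst), show s * (m + t - (m - t)) = 2 * (s * t) by ring]
    field_simp
  rw [h, ← exp_mul]
  congr 1
  field_simp

/-- The factors `exp (m * s)` separate off, leaving hyperbolic functions of `t`. Since `logSinhc`
and `langevin` vanish at `0`, the branches with a zero parameter need no separate formula. -/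
lemma stolarsky_exp (r s m t : ℝ) :
    stolarsky r s (exp (m + t)) (exp (m - t)) = exp (m + logStolarsky r s t) := by
  rcases eq_or_ne t 0 with rfl | ht
  · simp [stolarsky, logStolarsky]
  have hne : exp (m + t) ≠ exp (m - t) := by
    intro h
    have := exp_injective h
    apply ht
    linarith
  rw [stolarsky, if_neg hne]
  by_cases hrs : r = s
  · subst hrs
    rw [if_pos rfl, logStolarsky_self]
    by_cases hr : r = 0
    · subst hr
      rw [if_pos rfl, ← exp_add, show m + t + (m - t) = m + m by ring, exp_add,
        sqrt_mul_self (exp_pos m).le]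
      simp
    · rw [if_neg hr, log_exp, log_exp]
      have hrt : r * t ≠ 0 := mul_ne_zero hr ht
      have h1 := exp_add_rpow_sub_exp_sub_rpow m t r
      have h2 := exp_add_rpow_add_exp_sub_rpow m t r
      have h3 : exp (m + t) ^ r * (m + t) - exp (m - t) ^ r * (m - t)
          = m * (2 * exp (m * r) * sinh (r * t)) + t * (2 * exp (m * r) * cosh (r * t)) := by
        rw [← h1, ← h2]; ring
      rw [h3, h1, langevin]
      have := sinh_ne_zero_of_ne_zero hrt
      have := (exp_pos (m * r)).ne'
      congr 1
      field_simp
      ring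
  rw [if_neg hrs, logStolarsky, if_neg hrs]
  by_cases hr : r = 0
  · subst hr
    rw [if_pos rfl, rpow_sub_div_log_sub_rpow ht (Ne.symm hrs)]
    simp
  rw [if_neg hr]
  by_cases hs : s = 0
  · subst hs
    rw [if_pos rfl, rpow_sub_div_log_sub_rpow ht hrs]
    simp [neg_div_neg_eq]
  rw [if_neg hs]
  have hst : s * t ≠ 0 := mul_ne_zero hs ht
  have hrt : r * t ≠ 0 := mul_ne_zero hr ht
  have hsr : s - r ≠ 0 := sub_ne_zero.2 (Ne.symm hrs)
  have h : r * (exp (m + t) ^ s - exp (m - t) ^ s) / (s * (exp (m + t) ^ r - exp (m - t) ^ r))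
      = exp (m * (s - r) + (logSinhc (s * t) - logSinhc (r * t))) := by
    rw [exp_add_rpow_sub_exp_sub_rpow, exp_add_rpow_sub_exp_sub_rpow, mul_sub, exp_add, exp_sub,
      exp_sub, logSinhc, logSinhc, exp_log (sinh_div_self_pos hst),
      exp_log (sinh_div_self_pos hrt)]
    have := sinh_ne_zero_of_ne_zero hrt
    field_simp
  rw [h, ← exp_mul]
  congr 1
  field_simp

lemma exp_div_exp_add_exp (m t : ℝ) :
    exp (m + t) / (exp (m + t) + exp (m - t)) = exp t / (2 * cosh t) := by
  rw [sub_eq_add_neg, exp_add, exp_add, ← mul_add, mul_div_mul_left _ _ (exp_pos m).ne', cosh_eq]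
  congr 1; ring

lemma exp_div_exp_add_exp' (m t : ℝ) :
    exp (m - t) / (exp (m + t) + exp (m - t)) = exp (-t) / (2 * cosh t) := by
  have := exp_div_exp_add_exp m (-t)
  rwa [cosh_neg, sub_neg_eq_add, ← sub_eq_add_neg, add_comm (exp (m - t))] at this

lemma gini_exp (m t : ℝ) : gini (exp (m + t)) (exp (m - t)) = exp (m + t * tanh t) := by
  rw [gini, exp_div_exp_add_exp, exp_div_exp_add_exp', ← exp_mul, ← exp_mul, ← exp_add,
    tanh_eq_sinh_div_cosh]
  have := (cosh_pos t).ne'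
  congr 1
  field_simp
  rw [cosh_eq, sinh_eq]; ring

lemma giniDual_exp (m t : ℝ) :
    giniDual (exp (m + t)) (exp (m - t)) = exp (m + -(t * tanh t)) := by
  rw [giniDual, exp_div_exp_add_exp, exp_div_exp_add_exp', ← exp_mul, ← exp_mul, ← exp_add,
    tanh_eq_sinh_div_cosh]
  have := (cosh_pos t).ne'
  congr 1
  field_simp
  rw [cosh_eq, sinh_eq]; ring

/-! ### Membership in `Ω` -/

lemma abs_mul_tanh_le (t : ℝ) : |t * tanh t| ≤ |t| := by
  rw [abs_mul]
  exact mul_le_of_le_one_right (abs_nonneg t) (abs_tanh_lt_one t).le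

/-- A function of the form `√(ab) e^{f((log a - log b)/2)}` with `f` even and `|f(t)| ≤ |t|` is a
mean in `Ω`. -/
lemma isOmegaMean_of_exp {M : ℝ → ℝ → ℝ} {f : ℝ → ℝ}
    (hM : ∀ m t, M (exp (m + t)) (exp (m - t)) = exp (m + f t))
    (heven : ∀ t, f (-t) = f t) (hle : ∀ t, |f t| ≤ |t|) : IsOmegaMean M where
  min_le a b ha hb := by
    obtain ⟨m, t, rfl, rfl⟩ := exists_exp_add_exp_sub ha hb
    rw [hM, min_le_iff, exp_le_exp, exp_le_exp]
    have h := neg_le_of_abs_le (hle t)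
    rcases abs_cases t with ⟨h', -⟩ | ⟨h', -⟩
    · right; linarith
    · left; linarith
  le_max a b ha hb := by
    obtain ⟨m, t, rfl, rfl⟩ := exists_exp_add_exp_sub ha hb
    rw [hM, le_max_iff, exp_le_exp, exp_le_exp]
    have h := le_of_abs_le (hle t)
    rcases abs_cases t with ⟨h', -⟩ | ⟨h', -⟩
    · left; linarith
    · right; linarith
  symmetric a b ha hb := by
    obtain ⟨m, t, rfl, rfl⟩ := exists_exp_add_exp_sub ha hb
    have := hM m (-t)
    rw [sub_neg_eq_add, ← sub_eq_add_neg, heven] at this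
    rw [hM, this]
  reflexive a ha := by
    have h0 : f 0 = 0 := by simpa using hle 0
    have := hM (log a) 0
    rwa [h0, add_zero, sub_zero, exp_log ha] at this
  homogeneous c a b hc ha hb := by
    obtain ⟨m, t, rfl, rfl⟩ := exists_exp_add_exp_sub ha hb
    obtain ⟨d, rfl⟩ : ∃ d, c = exp d := ⟨log c, (exp_log hc).symm⟩
    rw [← exp_add, ← exp_add, ← add_assoc, ← add_sub_assoc, hM, hM, ← exp_add, add_assoc]

lemma isOmegaMean_stolarsky (r s : ℝ) : IsOmegaMean (stolarsky r s) :=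
  isOmegaMean_of_exp (stolarsky_exp r s) (logStolarsky_neg r s) (abs_logStolarsky_le r s)

lemma isOmegaMean_gini : IsOmegaMean gini :=
  isOmegaMean_of_exp gini_exp (by simp) abs_mul_tanh_le

lemma isOmegaMean_giniDual : IsOmegaMean giniDual :=
  isOmegaMean_of_exp giniDual_exp (by simp) (fun t => by rw [abs_neg]; exact abs_mul_tanh_le t)

/-! ### Comparison of means and inversion -/

lemma meanLE_iff_of_exp {M N : ℝ → ℝ → ℝ} {f g : ℝ → ℝ}
    (hM : ∀ m t, M (exp (m + t)) (exp (m - t)) = exp (m + f t))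
    (hN : ∀ m t, N (exp (m + t)) (exp (m - t)) = exp (m + g t)) :
    MeanLE M N ↔ ∀ t, f t ≤ g t := by
  constructor
  · intro h t
    have := h (exp (0 + t)) (exp (0 - t)) (exp_pos _) (exp_pos _)
    rw [hM, hN, exp_le_exp] at this
    linarith
  · intro h a b ha hb
    obtain ⟨m, t, rfl, rfl⟩ := exists_exp_add_exp_sub ha hb
    rw [hM, hN, exp_le_exp]
    linarith [h t]

lemma stolarsky_le_gini_iff (r s : ℝ) :
    MeanLE (stolarsky r s) gini ↔ ∀ t, logStolarsky r s t ≤ t * tanh t :=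
  meanLE_iff_of_exp (stolarsky_exp r s) gini_exp

lemma stolarsky_le_stolarsky_iff (r s p q : ℝ) :
    MeanLE (stolarsky r s) (stolarsky p q) ↔ ∀ t, logStolarsky r s t ≤ logStolarsky p q t :=
  meanLE_iff_of_exp (stolarsky_exp r s) (stolarsky_exp p q)

lemma logStolarsky_neg_neg (r s t : ℝ) :
    logStolarsky (-r) (-s) t = -logStolarsky r s t := by
  simp only [logStolarsky, neg_inj, neg_mul, langevin_neg, logSinhc_neg]
  split_ifs with h
  · ring
  · rw [← div_neg]; congr 1; ring

/-- Inversion `M(a,b) ↦ ab / M(a,b)` reverses the order and carries `S` to `S_*`. -/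
lemma giniDual_le_stolarsky_neg_iff (r s : ℝ) :
    MeanLE giniDual (stolarsky (-r) (-s)) ↔ MeanLE (stolarsky r s) gini := by
  rw [stolarsky_le_gini_iff, meanLE_iff_of_exp giniDual_exp (stolarsky_exp (-r) (-s))]
  simp only [logStolarsky_neg_neg, neg_le_neg_iff]

lemma stolarsky_neg_le_giniDual_iff (r s : ℝ) :
    MeanLE (stolarsky (-r) (-s)) giniDual ↔ MeanLE gini (stolarsky r s) := by
  rw [meanLE_iff_of_exp gini_exp (stolarsky_exp r s),
    meanLE_iff_of_exp (stolarsky_exp (-r) (-s)) giniDual_exp]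
  simp only [logStolarsky_neg_neg, neg_le_neg_iff]

lemma stolarsky_le_self {r s p : ℝ} (hr : r ≤ p) (hs : s ≤ p) :
    MeanLE (stolarsky r s) (stolarsky p p) := by
  rw [stolarsky_le_stolarsky_iff]
  intro t
  wlog h : r ≤ s generalizing r s
  · rw [logStolarsky_symm]; exact this hs hr (le_of_not_ge h)
  obtain ⟨ξ, hξ, he⟩ := exists_logStolarsky_eq t h
  rw [he, logStolarsky_self]
  exact mul_langevin_mono t (hξ.2.trans hs)

lemma self_le_stolarsky {r s p : ℝ} (hr : p ≤ r) (hs : p ≤ s) :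
    MeanLE (stolarsky p p) (stolarsky r s) := by
  have h := (stolarsky_le_stolarsky_iff _ _ _ _).1
    (stolarsky_le_self (neg_le_neg hr) (neg_le_neg hs))
  rw [stolarsky_le_stolarsky_iff]
  intro t
  simpa only [logStolarsky_neg_neg, neg_le_neg_iff] using h t

/-! ### Sharp comparison with `S` -/

lemma stolarsky_three_le_gini : MeanLE (stolarsky 3 3) gini := by
  rw [stolarsky_le_gini_iff]
  intro t
  wlog ht : 0 ≤ t generalizing t
  · simpa [logStolarsky_neg] using this (-t) (by linarith)
  rw [logStolarsky_self]
  rcases ht.eq_or_lt with rfl | ht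
  · simp
  have hs : 0 < sinh (3 * t) := sinh_pos_iff.2 (by positivity)
  have hc := cosh_pos t
  have h := three_mul_mul_cosh_le (u := 2 * t) (by positivity)
  -- Both sides equal `sinh (4 * t) + sinh (2 * t)`; this is where the parameter `3` meets
  -- Cusa–Huygens at `2 * t`.
  have key : sinh (2 * t) * (2 * cosh (2 * t) + 1) = 2 * (sinh (3 * t) * cosh t) := by
    rw [sinh_two_mul, cosh_two_mul, sinh_three_mul, cosh_sq]; ring
  have h2 : cosh (3 * t) * cosh t - sinh (3 * t) * sinh t = cosh (2 * t) := by
    rw [← cosh_sub]; congr 1; ring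
  have h3 : t * tanh t - t * langevin (3 * t) =
      (sinh (3 * t) * cosh t - 3 * t * (cosh (3 * t) * cosh t - sinh (3 * t) * sinh t)) /
        (3 * sinh (3 * t) * cosh t) := by
    rw [tanh_eq_sinh_div_cosh, langevin]; field_simp; ring
  rw [← sub_nonneg, h3, h2]
  exact div_nonneg (by linarith) (by positivity)

lemma le_three_of_stolarsky_le_gini {p : ℝ} (h : MeanLE (stolarsky p p) gini) : p ≤ 3 := by
  rw [stolarsky_le_gini_iff] at h
  rcases le_or_gt p 0 with hp | hp
  · linarith
  -- With `v = p * t`, the chain `v ^ 2 / (3 * sinh v) ≤ langevin v ≤ tanh (v / p) ≤ v / p` gives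
  -- this bound, and `v → 0` then forces `p ≤ 3`.
  have hv : ∀ v : ℝ, 0 < v → p / 3 ≤ sinh v / v := by
    intro v hv
    have h1 := h (v / p)
    have hs := sinh_pos_iff.2 hv
    have h2 : tanh (v / p) ≤ v / p := by
      rw [tanh_eq_sinh_div_cosh, div_le_iff₀ (cosh_pos _)]
      exact sinh_le_mul_cosh (by positivity)
    rw [logStolarsky_self, mul_div_cancel₀ v hp.ne', mul_le_mul_iff_right₀ (by positivity)] at h1
    have h3 : (v ^ 3 / 3) / (v * sinh v) ≤ langevin v := by
      have : langevin v = (v * cosh v - sinh v) / (v * sinh v) := by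
        rw [langevin]; field_simp
      rw [this]
      gcongr
      exact cube_div_three_le_mul_cosh_sub_sinh hv.le
    have h4 := h3.trans (h1.trans h2)
    rw [div_le_div_iff₀ (by positivity) hp] at h4
    rw [div_le_div_iff₀ three_pos hv]
    have : v ^ 2 * (p * v) ≤ v ^ 2 * (sinh v * 3) := by nlinarith
    exact le_of_mul_le_mul_left this (by positivity)
  have hlim : Tendsto (fun v : ℝ => sinh v / v) (𝓝[>] 0) (𝓝 1) := by
    have := (hasDerivAt_sinh 0).tendsto_slope_zero_right
    simpa [div_eq_inv_mul] using this
  have := ge_of_tendsto hlim (eventually_nhdsWithin_of_forall hv)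
  linarith

lemma not_gini_le_stolarsky (r s : ℝ) : ¬ MeanLE gini (stolarsky r s) := by
  intro h
  -- Enlarging to a diagonal mean leaves one parameter; `p ≥ 1` is needed for `coth (p * t) ≤ coth
  -- t`.
  set p := max 1 (max r s)
  have hp1 : 1 ≤ p := le_max_left _ _
  have hle : MeanLE gini (stolarsky p p) := fun a b ha hb => (h a b ha hb).trans
    (stolarsky_le_self ((le_max_left r s).trans (le_max_right _ _))
      ((le_max_right r s).trans (le_max_right _ _)) a b ha hb)
  rw [meanLE_iff_of_exp gini_exp (stolarsky_exp p p)] at hle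
  -- The hypothesis will force `sinh (2 * t) ≤ 2 * p * t`. With `t = 2 * p` the right side is `t ^
  -- 2`, which is less than `2 * t + 4 * t ^ 3 / 3 ≤ sinh (2 * t)`.
  obtain ⟨t, ht⟩ : ∃ t, t = 2 * p := ⟨_, rfl⟩
  have h1 := hle t
  rw [logStolarsky_self] at h1
  have htpos : 0 < t := by linarith
  have hpt : t ≤ p * t := le_mul_of_one_le_left htpos.le hp1
  have hs := sinh_pos_iff.2 htpos
  have hc := cosh_pos t
  have hspt := sinh_pos_iff.2 (htpos.trans_le hpt)
  have hcoth : cosh (p * t) / sinh (p * t) ≤ cosh t / sinh t := by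
    rw [div_le_div_iff₀ hspt hs]
    have h2 := sinh_sub (p * t) t
    have h3 : 0 ≤ sinh (p * t - t) := sinh_nonneg_iff.2 (by linarith)
    linarith
  have h2 : tanh t + 1 / (p * t) ≤ cosh t / sinh t := by
    have := le_of_mul_le_mul_left h1 htpos
    rw [langevin] at this
    linarith
  have h3 : cosh t / sinh t - tanh t = 2 / sinh (2 * t) := by
    have := cosh_sq t
    rw [tanh_eq_sinh_div_cosh, sinh_two_mul, div_sub_div _ _ hs.ne' hc.ne',
      show cosh t * cosh t - sinh t * sinh t = 1 by linarith, mul_assoc,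
      div_mul_cancel_left₀ two_ne_zero, one_div]
  have h4 : 1 / (p * t) ≤ 2 / sinh (2 * t) := by linarith
  rw [div_le_div_iff₀ (by positivity) (sinh_pos_iff.2 (by positivity))] at h4
  have h5 := self_add_cube_div_six_le_sinh (x := 2 * t) (by positivity)
  have h6 : p = t / 2 := by rw [ht]; ring
  rw [h6] at h4
  nlinarith [mul_pos htpos htpos, mul_pos (mul_pos htpos htpos) htpos, sq_nonneg (t - 1)]

/-! ### Cancelling means -/

lemma isRightCancelling_gini {Δ : Set (ℝ → ℝ → ℝ)} (hΔ : Δ ⊆ stolarskyClass)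
    (h3 : stolarsky 3 3 ∈ Δ) : IsRightCancelling Δ gini where
  subset_omega M hM := by
    obtain ⟨r, s, rfl⟩ := hΔ hM
    exact isOmegaMean_stolarsky r s
  mem_omega := isOmegaMean_gini
  exists_le := ⟨_, h3, stolarsky_three_le_gini⟩
  not_exists_ge := by
    rintro ⟨N, hN, h⟩
    obtain ⟨r, s, rfl⟩ := hΔ hN
    exact not_gini_le_stolarsky r s h

lemma giniDual_le_stolarsky_neg_three : MeanLE giniDual (stolarsky (-3) (-3)) :=
  (giniDual_le_stolarsky_neg_iff 3 3).2 stolarsky_three_le_gini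

lemma isLeftCancelling_giniDual {Δ : Set (ℝ → ℝ → ℝ)} (hΔ : Δ ⊆ stolarskyClass)
    (h3 : stolarsky (-3) (-3) ∈ Δ) : IsLeftCancelling Δ giniDual where
  subset_omega M hM := by
    obtain ⟨r, s, rfl⟩ := hΔ hM
    exact isOmegaMean_stolarsky r s
  mem_omega := isOmegaMean_giniDual
  exists_ge := ⟨_, h3, giniDual_le_stolarsky_neg_three⟩
  not_exists_le := by
    rintro ⟨N, hN, h⟩
    obtain ⟨r, s, rfl⟩ := hΔ hN
    refine not_gini_le_stolarsky (-r) (-s) ((stolarsky_neg_le_giniDual_iff _ _).1 ?_)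
    rwa [neg_neg, neg_neg]

lemma stolarskyDiagonal_subset : stolarskyDiagonal ⊆ stolarskyClass := by
  rintro _ ⟨s, rfl⟩
  exact ⟨s, s, rfl⟩

lemma isOrderedFamily_stolarskyDiagonal : IsOrderedFamily stolarskyDiagonal := by
  rintro _ ⟨p, rfl⟩ _ ⟨q, rfl⟩
  exact (le_total p q).imp (fun h => stolarsky_le_self h h) (fun h => stolarsky_le_self h h)

lemma giniDual_eq_mul_div_gini {a b : ℝ} (ha : 0 < a) (hb : 0 < b) :
    giniDual a b = a * b / gini a b := by
  obtain ⟨m, t, rfl, rfl⟩ := exists_exp_add_exp_sub ha hb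
  rw [giniDual_exp, gini_exp, ← exp_add, ← exp_sub]
  congr 1
  ring

end MeanHierarchy

theorem theorem3p2 :
    -- the chain of inequalities
    (∀ r s : ℝ, -3 ≤ r → r ≤ s → s ≤ 3 → ∀ a b : ℝ, 0 < a → 0 < b →
      MeanHierarchy.giniDual a b ≤ MeanHierarchy.stolarsky (-3) (-3) a b ∧
      MeanHierarchy.stolarsky (-3) (-3) a b ≤ MeanHierarchy.stolarsky r s a b ∧
      MeanHierarchy.stolarsky r s a b ≤ MeanHierarchy.stolarsky 3 3 a b ∧
      MeanHierarchy.stolarsky 3 3 a b ≤ MeanHierarchy.gini a b) ∧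
    -- the constants `-3` and `3` are best possible
    IsLeast {p : ℝ | MeanHierarchy.MeanLE MeanHierarchy.giniDual (MeanHierarchy.stolarsky p p)}
      (-3) ∧
    IsGreatest {p : ℝ | MeanHierarchy.MeanLE (MeanHierarchy.stolarsky p p) MeanHierarchy.gini} 3 ∧
    -- the left end of the chain is `ab / S(a,b)`
    (∀ a b : ℝ, 0 < a → 0 < b → MeanHierarchy.giniDual a b = a * b / MeanHierarchy.gini a b) ∧
    -- cancelling means of the class of all `I_{r,s}`
    MeanHierarchy.IsLeftCancelling MeanHierarchy.stolarskyClass MeanHierarchy.giniDual ∧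
    MeanHierarchy.IsRightCancelling MeanHierarchy.stolarskyClass MeanHierarchy.gini ∧
    -- cancelling means of the ordered class of all `I_{s,s}`
    MeanHierarchy.IsOrderedFamily MeanHierarchy.stolarskyDiagonal ∧
    MeanHierarchy.IsLeftCancelling MeanHierarchy.stolarskyDiagonal MeanHierarchy.giniDual ∧
    MeanHierarchy.IsRightCancelling MeanHierarchy.stolarskyDiagonal MeanHierarchy.gini := by
  open MeanHierarchy in
  refine ⟨fun r s hr hrs hs a b ha hb => ⟨giniDual_le_stolarsky_neg_three a b ha hb,
      self_le_stolarsky hr (hr.trans hrs) a b ha hb,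
      stolarsky_le_self (hrs.trans hs) hs a b ha hb, stolarsky_three_le_gini a b ha hb⟩,
    ⟨giniDual_le_stolarsky_neg_three, fun p hp => ?_⟩,
    ⟨stolarsky_three_le_gini, fun p hp => le_three_of_stolarsky_le_gini hp⟩,
    fun a b ha hb => giniDual_eq_mul_div_gini ha hb,
    isLeftCancelling_giniDual subset_rfl ⟨-3, -3, rfl⟩,
    isRightCancelling_gini subset_rfl ⟨3, 3, rfl⟩,
    isOrderedFamily_stolarskyDiagonal,
    isLeftCancelling_giniDual stolarskyDiagonal_subset ⟨-3, rfl⟩,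
    isRightCancelling_gini stolarskyDiagonal_subset ⟨3, rfl⟩⟩
  have h : -p ≤ 3 := by
    refine MeanHierarchy.le_three_of_stolarsky_le_gini
      ((MeanHierarchy.giniDual_le_stolarsky_neg_iff _ _).1 ?_)
    rwa [neg_neg]
  linarith
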